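/- Let $G$ be a finite simple graph on $n$ vertices, let $k$ be a non-negative integer with $2k\le n$, and let $\lambda_1>\lambda_2>\dots>\lambda_k>0$ be real numbers. The matching number $\operatorname{match}(G)$ is the number of edges in a maximum matching of $G$. Let $S^-(G)$ denote the set of real skew-symmetric matrices $A=[a_{ij}]$, with rows and columns indexed by the vertices of $G$, such that for all distinct vertices $i,j$ one has $a_{ij}\neq 0$ if and only if $\{i,j\}$ is an edge of $G$. Eigenvalues are complex and are counted with algebraic multiplicity. Then $\operatorname{match}(G)=k$ if and only if both of the following hold: (a) there is a matrix $A\in S^-(G)$ whose eigenvalues are $\pm i\lambda_1,\dots,\pm i\lambda_k$ and $n-2k$ zeros; (b) every matrix $A\in S^-(G)$ has at most $2k$ nonzero eigenvalues. -/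

import Mathlib

/-- The matching number of a finite graph: the number of edges of a maximum matching. -/
noncomputable def matchingNumber {V : Type*} (G : SimpleGraph V) : ℕ :=
  sSup {m : ℕ | ∃ M : G.Subgraph, M.IsMatching ∧ M.edgeSet.ncard = m}

/-- For a finite graph the supremum above is attained: it is a genuine maximum. -/
theorem matchingNumber_isGreatest {V : Type*} [Finite V] (G : SimpleGraph V) :
    IsGreatest {m : ℕ | ∃ M : G.Subgraph, M.IsMatching ∧ M.edgeSet.ncard = m}
      (matchingNumber G) := by
  have hne : {m : ℕ | ∃ M : G.Subgraph, M.IsMatching ∧ M.edgeSet.ncard = m}.Nonempty :=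
    ⟨0, ⊥, fun v hv => by simp at hv, by simp⟩
  have hbdd : BddAbove {m : ℕ | ∃ M : G.Subgraph, M.IsMatching ∧ M.edgeSet.ncard = m} := by
    refine ⟨(Set.univ : Set (Sym2 V)).ncard, ?_⟩
    rintro m ⟨M, -, rfl⟩
    exact Set.ncard_le_ncard (Set.subset_univ _) (Set.toFinite _)
  exact ⟨Nat.sSup_mem hne hbdd, fun m hm => le_csSup hbdd hm⟩

/-- The graph of a square matrix `A`: distinct `i`, `j` are adjacent when `A i j ≠ 0` or
`A j i ≠ 0` (for a skew-symmetric matrix the two conditions agree). -/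
def graphOfMatrix {V : Type*} (A : Matrix V V ℝ) : SimpleGraph V :=
  SimpleGraph.fromRel fun i j => A i j ≠ 0

/-- The set of all real skew-symmetric matrices whose graph is `G`. -/
def skewMatricesOf {V : Type*} (G : SimpleGraph V) : Set (Matrix V V ℝ) :=
  {A | A.transpose = -A ∧ graphOfMatrix A = G}

/-- The multiset of complex eigenvalues of a real square matrix, each one repeated according
to its algebraic multiplicity. -/
noncomputable def complexEigenvalues {V : Type*} [Fintype V] [DecidableEq V]
    (A : Matrix V V ℝ) : Multiset ℂ :=
  (A.map (fun x : ℝ => (x : ℂ))).charpoly.roots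

/-!
Two facts about the matrices of a graph `G` are combined.

A skew-symmetric matrix of `G` has at most twice the matching number of nonzero eigenvalues
(`card_nonzero_complexEigenvalues_le`). Their number is at most the rank `r`; a skew-symmetric
matrix of rank `r` has a nonsingular principal submatrix of size `r`
(`Matrix.exists_nondegenerateOn_card_eq_rank`); and the index set of a nonsingular principal
submatrix is perfectly matched by nonzero entries (`Matrix.NondegenerateOn.exists_isMatching`).
The last step is an induction: the inverse is again skew-symmetric, so its `2 × 2` principal minors
are squares of entries, and by Jacobi's complementary minor formula two indices `v`, `w` at which
the matrix and its inverse are both nonzero can be removed. The formula itself is replaced by a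
direct argument with vectors.

Conversely, a graph of matching number `k` realizes all spectra `±i lam j` with `k` distinct
`lam j > 0` (`exists_complexEigenvalues_eq`). The direct sum of the blocks
`!![0, lam j; -lam j, 0]` along a maximum matching has these eigenvalues. When a small multiple `ε`
of a matrix `B` of `G` is added, the weights of the matching can be adjusted so that `±i lam j`
remain eigenvalues: the real functions `re det (lam j + iA)` of the weights `t` are, at `ε = 0`,
constant multiples of `∏ l, (lam j ^ 2 - t l ^ 2)`, so their Jacobian at `t = lam` is diagonal and
invertible, and a map with surjective strict derivative is open at the point
(`Matrix.exists_reDet_weightedMatching_add_eq_zero`). The first fact forces the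
remaining eigenvalues to vanish.

Thus twice the matching number is the largest number of nonzero eigenvalues among the matrices of
`G`, and it is attained with any prescribed conjugate pairs.
-/

/-! ### Rank and nonzero eigenvalues -/

namespace Matrix

/-- The eigenvalue `0` has algebraic multiplicity at least its geometric multiplicity, so at most
`rank A` roots of the characteristic polynomial are nonzero. -/
theorem card_nonzero_roots_charpoly_le_rank {K V : Type*} [Field K] [DecidableEq K] [Fintype V]
    [DecidableEq V] (A : Matrix V V K) :
    (A.charpoly.roots.filter (fun z => z ≠ 0)).card ≤ A.rank := by
  have h1 : (A.charpoly.roots.filter (fun z => z ≠ 0)).card + A.charpoly.roots.count 0 ≤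
      Fintype.card V := by
    have h := A.charpoly.card_roots'
    rw [charpoly_natDegree_eq_dim] at h
    refine le_trans (le_of_eq ?_) h
    rw [← Multiset.countP_eq_card_filter, Multiset.count,
      Multiset.card_eq_countP_add_countP (fun z => (0 : K) ≠ z) A.charpoly.roots]
    simp only [ne_eq, not_not, eq_comm]
  have h2 : Module.finrank K (LinearMap.ker A.toLin') ≤ A.charpoly.roots.count 0 := by
    rw [Polynomial.count_roots, ← charpoly_toLin',
      ← LinearMap.finrank_maxGenEigenspace_eq A.toLin' 0]
    apply Submodule.finrank_mono
    rw [← Module.End.eigenspace_zero]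
    exact Module.End.genEigenspace_le_maximal _ _ 1
  have h3 := LinearMap.finrank_range_add_finrank_ker A.toLin'
  rw [Module.finrank_fintype_fun_eq_card] at h3
  have h4 : A.rank = Module.finrank K (LinearMap.range A.toLin') := by
    rw [rank, toLin'_apply']
  omega

/-! ### Nondegenerate principal submatrices and matchings -/

/-- The principal submatrix of `A` on the index set `S` is nonsingular. Instead of matrices indexed
by `S`, the definition uses vectors on the whole index type that vanish outside `S`. -/
def NondegenerateOn {K V : Type*} [Field K] [Fintype V] (A : Matrix V V K) (S : Finset V) : Prop :=
  ∀ x : V → K, (∀ u ∉ S, x u = 0) → (∀ u ∈ S, (A *ᵥ x) u = 0) → x = 0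

/-- If the rows in `S` are a basis of the row space, the principal submatrix on `S` is
nonsingular: a vector of its kernel is killed by all of `A`, hence by skew-symmetry gives a linear
relation between the rows in `S`. -/
theorem exists_nondegenerateOn_card_eq_rank {K V : Type*} [Field K] [Fintype V]
    {A : Matrix V V K} (hA : Aᵀ = -A) :
    ∃ S : Finset V, A.NondegenerateOn S ∧ S.card = A.rank := by
  classical
  obtain ⟨κ, a, ha, hsp, hli⟩ := exists_linearIndependent' K A.row
  have : Fintype κ := Fintype.ofInjective a ha
  refine ⟨Finset.univ.image a, ?_, ?_⟩
  · intro x hx hAx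
    have hall : ∀ u, A.row u ⬝ᵥ x = 0 := by
      have hle : Submodule.span K (Set.range A.row) ≤
          LinearMap.ker ((dotProductBilin K K).flip x) := by
        rw [← hsp, Submodule.span_le]
        rintro _ ⟨i, rfl⟩
        exact hAx (a i) (Finset.mem_image_of_mem _ (Finset.mem_univ _))
      intro u
      exact hle (Submodule.subset_span ⟨u, rfl⟩)
    have hrel : ∑ i, x (a i) • (A.row ∘ a) i = 0 := by
      have hx' : x ᵥ* A = 0 := by
        have h0 : A *ᵥ x = 0 := funext hall
        rw [← mulVec_transpose, hA, neg_mulVec, h0, neg_zero]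
      rw [← hx']
      funext w
      rw [vecMul, dotProduct, Finset.sum_apply,
        ← Finset.sum_subset (Finset.subset_univ (Finset.univ.image a))
          (fun u _ hu => by rw [hx u hu, zero_mul]),
        Finset.sum_image (fun i _ j _ h => ha h)]
      rfl
    have hz := Fintype.linearIndependent_iff.1 hli _ hrel
    funext u
    by_cases hu : u ∈ Finset.univ.image a
    · obtain ⟨i, -, rfl⟩ := Finset.mem_image.1 hu
      exact hz i
    · exact hx u hu
  · rw [Finset.card_image_of_injective _ ha, Finset.card_univ, rank_eq_finrank_span_row, ← hsp,
      finrank_span_eq_card hli]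

/-- The inverse of a nonsingular principal submatrix, one column at a time. -/
theorem NondegenerateOn.exists_mulVec_eq_single {K V : Type*} [Field K] [Fintype V]
    [DecidableEq V] {A : Matrix V V K} {S : Finset V} (h : A.NondegenerateOn S) {v : V}
    (hv : v ∈ S) :
    ∃ y : V → K, (∀ u ∉ S, y u = 0) ∧ ∀ u ∈ S, (A *ᵥ y) u = (Pi.single v 1 : V → K) u := by
  -- `T` agrees with `A` on the rows in `S` and with the identity on the others.
  let T : Matrix V V K := fun u => if u ∈ S then A u else (1 : Matrix V V K) u
  have hT1 : ∀ x : V → K, ∀ u ∈ S, (T *ᵥ x) u = (A *ᵥ x) u := fun x u hu => by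
    simp [T, mulVec, hu]
  have hT2 : ∀ x : V → K, ∀ u ∉ S, (T *ᵥ x) u = x u := fun x u hu => by
    rw [← congrFun (one_mulVec x) u]
    simp only [T, mulVec, hu, if_false]
  have hinj : Function.Injective T.mulVec := by
    change Function.Injective T.mulVecLin
    rw [injective_iff_map_eq_zero]
    intro x hx
    rw [mulVecLin_apply] at hx
    exact h x (fun u hu => by rw [← hT2 x u hu, hx]; rfl)
      (fun u hu => by rw [← hT1 x u hu, hx]; rfl)
  obtain ⟨y, hy⟩ :=
    mulVec_surjective_iff_isUnit.2 (mulVec_injective_iff_isUnit.1 hinj) (Pi.single v 1)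
  refine ⟨y, fun u hu => ?_, fun u hu => ?_⟩
  · rw [← hT2 y u hu, hy, Pi.single_eq_of_ne]
    rintro rfl
    exact hu hv
  · rw [← hT1 y u hu, hy]

/-- Skew-symmetry as antisymmetry of the associated bilinear form. -/
theorem dotProduct_mulVec_skew {K V : Type*} [Field K] [Fintype V] {A : Matrix V V K}
    (hA : Aᵀ = -A) (x y : V → K) : x ⬝ᵥ A *ᵥ y = -(y ⬝ᵥ A *ᵥ x) := by
  rw [dotProduct_mulVec, ← mulVec_transpose, hA, neg_mulVec, neg_dotProduct, dotProduct_comm]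

/-- With `y` the column `v` of the inverse of the principal submatrix on `S`, the row `v` of `A`
and `y` have a common nonzero position `w`. The complementary minor of the entry `y w` of the
skew-symmetric inverse is then nonzero, so `v` and `w` can be removed from `S`. -/
theorem NondegenerateOn.exists_erase_erase {K V : Type*} [Field K] [NeZero (2 : K)] [Fintype V]
    [DecidableEq V] {A : Matrix V V K} (hA : Aᵀ = -A) {S : Finset V} (h : A.NondegenerateOn S)
    {v : V} (hv : v ∈ S) :
    ∃ w ∈ S, w ≠ v ∧ A v w ≠ 0 ∧ A.NondegenerateOn ((S.erase v).erase w) := by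
  obtain ⟨y, hy0, hy⟩ := h.exists_mulVec_eq_single hv
  have hdiag : A v v = 0 := by
    have h1 : A v v = -A v v := congrFun (congrFun hA v) v
    have h2 : (2 : K) * A v v = 0 := by linear_combination h1
    exact (mul_eq_zero.1 h2).resolve_left (NeZero.ne 2)
  have hyv : y v = 0 := by
    have h1 := dotProduct_mulVec_skew hA y y
    have h3 : y ⬝ᵥ A *ᵥ y = y v := by
      rw [dotProduct, Finset.sum_eq_single v]
      · rw [hy v hv, Pi.single_eq_same, mul_one]
      · intro u _ huv
        by_cases hu : u ∈ S
        · rw [hy u hu, Pi.single_eq_of_ne huv, mul_zero]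
        · rw [hy0 u hu, zero_mul]
      · exact fun hn => absurd (Finset.mem_univ v) hn
    rw [h3] at h1
    have h2 : (2 : K) * y v = 0 := by linear_combination h1
    exact (mul_eq_zero.1 h2).resolve_left (NeZero.ne 2)
  obtain ⟨w, -, hw⟩ : ∃ w ∈ Finset.univ, A v w * y w ≠ 0 := by
    apply Finset.exists_ne_zero_of_sum_ne_zero
    have h1 : ∑ w, A v w * y w = 1 := by
      simpa [mulVec, dotProduct] using hy v hv
    rw [h1]
    exact one_ne_zero
  have hyw : y w ≠ 0 := right_ne_zero_of_mul hw
  have hwS : w ∈ S := by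
    by_contra hn
    exact hyw (hy0 w hn)
  have hwv : w ≠ v := by
    rintro rfl
    exact hyw hyv
  refine ⟨w, hwS, hwv, left_ne_zero_of_mul hw, fun x hx0 hx => ?_⟩
  have hxv : x v = 0 := hx0 v (by simp)
  have hxw : x w = 0 := hx0 w (by simp)
  have hxS : ∀ u ∉ S, x u = 0 := fun u hu => hx0 u (by simp [hu])
  -- Pairing with `y` shows that `A *ᵥ x` vanishes at `w`.
  have hAxw : (A *ᵥ x) w = 0 := by
    have h1 : x ⬝ᵥ A *ᵥ y = 0 := by
      refine Finset.sum_eq_zero fun u _ => ?_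
      by_cases hu : u ∈ S
      · rw [hy u hu]
        by_cases huv : u = v
        · rw [huv, hxv, zero_mul]
        · rw [Pi.single_eq_of_ne huv, mul_zero]
      · rw [hxS u hu, zero_mul]
    have h2 : y ⬝ᵥ A *ᵥ x = y w * (A *ᵥ x) w := by
      rw [dotProduct, Finset.sum_eq_single w]
      · intro u _ huw
        by_cases hu : u ∈ S
        · by_cases huv : u = v
          · rw [huv, hyv, zero_mul]
          · rw [hx u (by simp [huw, huv, hu]), mul_zero]
        · rw [hy0 u hu, zero_mul]
      · exact fun hn => absurd (Finset.mem_univ w) hn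
    rw [dotProduct_mulVec_skew hA, neg_eq_zero, h2] at h1
    exact (mul_eq_zero.1 h1).resolve_left hyw
  -- On `S` the vector `A *ᵥ x` is a multiple of the unit vector at `v`, hence `x` is one of `y`.
  have hxy : x - (A *ᵥ x) v • y = 0 := by
    refine h _ (fun u hu => by simp [hxS u hu, hy0 u hu]) fun u hu => ?_
    rw [mulVec_sub, mulVec_smul, Pi.sub_apply, Pi.smul_apply, hy u hu, smul_eq_mul]
    by_cases huv : u = v
    · rw [huv, Pi.single_eq_same, mul_one, sub_self]
    · rw [Pi.single_eq_of_ne huv, mul_zero, sub_zero]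
      by_cases huw : u = w
      · rw [huw, hAxw]
      · exact hx u (by simp [huw, huv, hu])
  have hc : (A *ᵥ x) v = 0 := by
    have h1 := congrFun hxy w
    simp only [Pi.sub_apply, Pi.smul_apply, hxw, smul_eq_mul, zero_sub, Pi.zero_apply,
      neg_eq_zero] at h1
    exact (mul_eq_zero.1 h1).resolve_right hyw
  rwa [hc, zero_smul, sub_zero] at hxy

/-- A nonsingular principal submatrix forces a perfect matching of its index set, in any graph
that contains the positions of the nonzero entries. -/
theorem NondegenerateOn.exists_isMatching {K V : Type*} [Field K] [NeZero (2 : K)] [Fintype V]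
    [DecidableEq V] {A : Matrix V V K} (hA : Aᵀ = -A) (G : SimpleGraph V)
    (hG : ∀ u v, u ≠ v → A u v ≠ 0 → G.Adj u v) (S : Finset V) (h : A.NondegenerateOn S) :
    ∃ M : G.Subgraph, M.IsMatching ∧ M.verts = S ∧ 2 * M.edgeSet.ncard = S.card := by
  induction hs : S.card using Nat.strong_induction_on generalizing S with
  | _ s ih =>
  rcases S.eq_empty_or_nonempty with rfl | ⟨v, hv⟩
  · refine ⟨⊥, fun v hv => by simp at hv, by simp, ?_⟩
    rw [← hs]
    simp
  obtain ⟨w, hw, hwv, hvw, h'⟩ := h.exists_erase_erase hA hv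
  have hw' : w ∈ S.erase v := Finset.mem_erase.2 ⟨hwv, hw⟩
  have hcard : ((S.erase v).erase w).card + 2 = s := by
    have h1 := Finset.card_erase_add_one hv
    have h2 := Finset.card_erase_add_one hw'
    omega
  obtain ⟨M, hM, hMv, hMc⟩ := ih _ (by omega) _ h' rfl
  have hadj : G.Adj v w := hG v w hwv.symm hvw
  have hvM : v ∉ M.verts := by rw [hMv]; simp
  refine ⟨M ⊔ G.subgraphOfAdj hadj, hM.sup (.subgraphOfAdj hadj) ?_, ?_, ?_⟩
  · rw [hM.support_eq_verts, (SimpleGraph.Subgraph.IsMatching.subgraphOfAdj hadj).support_eq_verts,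
      hMv, Set.disjoint_right]
    simp
  · rw [SimpleGraph.Subgraph.verts_sup, hMv]
    ext u
    by_cases huv : u = v
    · simp [huv, hv]
    · by_cases huw : u = w
      · simp [huw, hw]
      · simp [huv, huw]
  · have hn : s(v, w) ∉ M.edgeSet := fun he => hvM (M.edge_vert he)
    rw [SimpleGraph.Subgraph.edgeSet_sup, SimpleGraph.edgeSet_subgraphOfAdj, Set.union_singleton,
      Set.ncard_insert_of_notMem hn (Set.toFinite _)]
    omega

end Matrix

/-- The entries of a matrix of graph `G` off the diagonal are nonzero exactly at the edges. -/
theorem adj_iff_of_mem_skewMatricesOf {V : Type*} {G : SimpleGraph V} {A : Matrix V V ℝ}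
    (hA : A ∈ skewMatricesOf G) {u v : V} (huv : u ≠ v) : G.Adj u v ↔ A u v ≠ 0 := by
  obtain ⟨hskew, rfl⟩ := hA
  have h : A v u = -A u v := congrFun (congrFun hskew u) v
  simp [graphOfMatrix, huv, h]

theorem card_nonzero_complexEigenvalues_le {V : Type*} [Fintype V] [DecidableEq V]
    {G : SimpleGraph V} {A : Matrix V V ℝ} (hA : A ∈ skewMatricesOf G) :
    ((complexEigenvalues A).filter (fun z => z ≠ 0)).card ≤ 2 * matchingNumber G := by
  have hskew : (A.map (fun x : ℝ => (x : ℂ))).transpose = -A.map (fun x : ℝ => (x : ℂ)) := by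
    ext u v
    have h : A v u = -A u v := congrFun (congrFun hA.1 u) v
    simp [h]
  obtain ⟨S, hS, hSr⟩ := Matrix.exists_nondegenerateOn_card_eq_rank hskew
  obtain ⟨M, hM, -, hMc⟩ := hS.exists_isMatching hskew G
    (fun u v huv h => (adj_iff_of_mem_skewMatricesOf hA huv).2 (by simpa using h))
  have hle : M.edgeSet.ncard ≤ matchingNumber G :=
    (matchingNumber_isGreatest G).2 ⟨M, hM, rfl⟩
  have hr := Matrix.card_nonzero_roots_charpoly_le_rank (A.map (fun x : ℝ => (x : ℂ)))
  unfold complexEigenvalues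
  convert hr.trans (by omega : _ ≤ 2 * matchingNumber G)

/-! ### Perturbation of a weighted matching -/

namespace Matrix

/-- The real polynomial function `c ↦ re det (c + iA)`. For a skew-symmetric matrix `A` the matrix
`iA` is Hermitian, so the determinant is real; up to a power of `i` it is the value of the
characteristic polynomial of `A` at `ic`. -/
noncomputable def reDet {V : Type*} [Fintype V] [DecidableEq V] (A : Matrix V V ℝ) (c : ℝ) : ℝ :=
  ((c : ℂ) • (1 : Matrix V V ℂ) + Complex.I • A.map (fun x : ℝ => (x : ℂ))).det.re

theorem isRoot_charpoly_of_reDet_eq_zero {V : Type*} [Fintype V] [DecidableEq V]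
    {A : Matrix V V ℝ} (hA : Aᵀ = -A) {c : ℝ} (h : A.reDet c = 0) :
    (A.map (fun x : ℝ => (x : ℂ))).charpoly.IsRoot (Complex.I * c) ∧
      (A.map (fun x : ℝ => (x : ℂ))).charpoly.IsRoot (-(Complex.I * c)) := by
  set B := A.map (fun x : ℝ => (x : ℂ)) with hB
  have hBt : Bᵀ = -B := by
    ext u v
    have h : A v u = -A u v := congrFun (congrFun hA u) v
    simp [hB, h]
  have hdet : ((c : ℂ) • (1 : Matrix V V ℂ) + Complex.I • B).det = 0 := by
    have him : star ((c : ℂ) • (1 : Matrix V V ℂ) + Complex.I • B).det =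
        ((c : ℂ) • (1 : Matrix V V ℂ) + Complex.I • B).det := by
      rw [← det_conjTranspose]
      congr 1
      have hBc : Bᴴ = -B := by
        rw [← hBt]
        ext u v
        simp [hB]
      rw [conjTranspose_add, conjTranspose_smul, conjTranspose_smul, hBc, conjTranspose_one]
      simp
    exact Complex.ext h (Complex.conj_eq_iff_im.1 him)
  have h1 : ((Complex.I * c) • (1 : Matrix V V ℂ) - B).det = 0 := by
    have : (Complex.I * c) • (1 : Matrix V V ℂ) - B =
        Complex.I • ((c : ℂ) • (1 : Matrix V V ℂ) + Complex.I • B) := by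
      rw [smul_add, smul_smul, smul_smul, Complex.I_mul_I, neg_one_smul, sub_eq_add_neg]
    rw [this, det_smul, hdet, mul_zero]
  have h2 : ((-(Complex.I * c)) • (1 : Matrix V V ℂ) - B).det = 0 := by
    have : (-(Complex.I * c)) • (1 : Matrix V V ℂ) - B =
        -((Complex.I * c) • (1 : Matrix V V ℂ) - B)ᵀ := by
      rw [transpose_sub, hBt, transpose_smul, transpose_one, neg_smul]
      abel
    rw [this, det_neg, det_transpose, h1, mul_zero]
  constructor
  · rw [Polynomial.IsRoot, eval_charpoly, scalar_apply, ← smul_one_eq_diagonal, h1]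
  · rw [Polynomial.IsRoot, eval_charpoly, scalar_apply, ← smul_one_eq_diagonal, h2]

/-- The direct sum of the skew-symmetric blocks `!![0, t l; -t l, 0]` and a zero block: the matrix
of a matching with weights `t`. -/
def weightedMatching {ι : Type*} [DecidableEq ι] (R : Type*) (t : ι → ℝ) :
    Matrix ((Fin 2 × ι) ⊕ R) ((Fin 2 × ι) ⊕ R) ℝ :=
  fromBlocks (blockDiagonal fun l => t l • !![0, 1; -1, 0]) 0 0 0

theorem reDet_weightedMatching {ι R : Type*} [Fintype ι] [DecidableEq ι] [Fintype R]
    [DecidableEq R] (t : ι → ℝ) (c : ℝ) :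
    (weightedMatching R t).reDet c = (∏ l, (c ^ 2 - t l ^ 2)) * c ^ Fintype.card R := by
  have h : (c : ℂ) • (1 : Matrix ((Fin 2 × ι) ⊕ R) ((Fin 2 × ι) ⊕ R) ℂ) +
      Complex.I • (weightedMatching R t).map (fun x : ℝ => (x : ℂ)) =
      fromBlocks (blockDiagonal fun l => !![(c : ℂ), Complex.I * t l; -(Complex.I * t l), c]) 0 0
        ((c : ℂ) • 1) := by
    ext (⟨a, l⟩ | r) (⟨b, l'⟩ | r')
    · by_cases hl : l = l'
      · subst hl
        fin_cases a <;> fin_cases b <;>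
          simp [weightedMatching, blockDiagonal_apply]
      · simp [weightedMatching, blockDiagonal_apply, hl]
    · simp [weightedMatching]
    · simp [weightedMatching]
    · simp [weightedMatching, one_apply]
  rw [reDet, h, det_fromBlocks_zero₂₁, det_blockDiagonal, det_smul, det_one, mul_one]
  have h2 : ∀ l, (!![(c : ℂ), Complex.I * t l; -(Complex.I * t l), c]).det =
      ((c ^ 2 - t l ^ 2 : ℝ) : ℂ) := fun l => by
    rw [det_fin_two_of]
    push_cast
    linear_combination (t l : ℂ) ^ 2 * Complex.I_sq
  simp only [h2]
  rw [← Complex.ofReal_prod, ← Complex.ofReal_pow, ← Complex.ofReal_mul, Complex.ofReal_re]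

theorem contDiff_reDet_weightedMatching_add {ι R : Type*} [Fintype ι] [DecidableEq ι] [Fintype R]
    [DecidableEq R] (B : Matrix ((Fin 2 × ι) ⊕ R) ((Fin 2 × ι) ⊕ R) ℝ) (c : ℝ) :
    ContDiff ℝ 1 fun p : (ι → ℝ) × ℝ => (weightedMatching R p.1 + p.2 • B).reDet c := by
  have hM : ∀ i j, ContDiff ℝ 1 fun p : (ι → ℝ) × ℝ => weightedMatching R p.1 i j := by
    rintro (⟨a, l⟩ | r) (⟨b, l'⟩ | r')
    · simp only [weightedMatching, fromBlocks_apply₁₁, blockDiagonal_apply, smul_apply, smul_eq_mul]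
      split_ifs
      · fun_prop
      · exact contDiff_const
    all_goals
      simp only [weightedMatching, fromBlocks_apply₁₂, fromBlocks_apply₂₁, fromBlocks_apply₂₂,
        zero_apply]
      exact contDiff_const
  unfold reDet
  refine Complex.reCLM.contDiff.comp ?_
  simp only [det_apply]
  refine ContDiff.sum fun σ _ => ContDiff.const_smul _ (contDiff_prod fun i _ => ?_)
  simp only [add_apply, smul_apply, map_apply, smul_eq_mul]
  refine contDiff_const.add (contDiff_const.mul (Complex.ofRealCLM.contDiff.comp ?_))
  exact (hM _ _).add (contDiff_snd.mul contDiff_const)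

/-- The numbers `±i lam j` remain eigenvalues of arbitrarily small perturbations of a weighted
matching in any prescribed direction `B`, if the weights are adjusted. The values of `reDet` at the
`lam j` have, as functions of the weights, an invertible diagonal Jacobian at `lam`. -/
theorem exists_reDet_weightedMatching_add_eq_zero {ι R : Type*} [Fintype ι] [DecidableEq ι]
    [Fintype R] [DecidableEq R] (B : Matrix ((Fin 2 × ι) ⊕ R) ((Fin 2 × ι) ⊕ R) ℝ)
    {lam : ι → ℝ} (hinj : Function.Injective lam) (hpos : ∀ j, 0 < lam j)
    {U : Set ((ι → ℝ) × ℝ)} (hU : U ∈ nhds (lam, (0 : ℝ))) :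
    ∃ p ∈ U, p.2 ≠ 0 ∧ ∀ j, (weightedMatching R p.1 + p.2 • B).reDet (lam j) = 0 := by
  set F : (ι → ℝ) × ℝ → ι → ℝ :=
    fun p j => (weightedMatching R p.1 + p.2 • B).reDet (lam j) with hF
  have hF0 : ∀ t j, F (t, 0) j =
      (∏ l, (lam j ^ 2 - t l ^ 2)) * lam j ^ Fintype.card R := fun t j => by
    rw [hF, ← reDet_weightedMatching]
    simp
  have hsm : ContDiff ℝ 1 F :=
    contDiff_pi.2 fun j => contDiff_reDet_weightedMatching_add B (lam j)
  have hder := (hsm.contDiffAt (x := (lam, (0 : ℝ)))).hasStrictFDerivAt one_ne_zero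
  set F' := fderiv ℝ F (lam, (0 : ℝ)) with hF'
  let d : ι → ℝ := fun j => -(2 * lam j) *
    ((∏ l ∈ Finset.univ.erase j, (lam j ^ 2 - lam l ^ 2)) * lam j ^ Fintype.card R)
  have hd : ∀ j, d j ≠ 0 := fun j => by
    refine mul_ne_zero (by simp [(hpos j).ne']) (mul_ne_zero ?_ (pow_ne_zero _ (hpos j).ne'))
    refine Finset.prod_ne_zero_iff.2 fun l hl h => (Finset.mem_erase.1 hl).1 (hinj ?_)
    exact ((sq_eq_sq₀ (hpos j).le (hpos l).le).1 (sub_eq_zero.1 h)).symm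
  -- The Jacobian in the weights, computed along lines through `lam`.
  have hpartial : ∀ v j, F' (v, 0) j = d j * v j := by
    intro v j
    have hline : HasDerivAt (fun s : ℝ => (lam + s • v, (0 : ℝ))) (v, (0 : ℝ)) 0 := by
      have := ((hasDerivAt_id (0 : ℝ)).smul_const v).const_add lam
      rw [one_smul] at this
      exact this.prodMk (hasDerivAt_const 0 (0 : ℝ))
    have h1 : HasDerivAt (fun s : ℝ => F (lam + s • v, 0) j) (F' (v, 0) j) 0 := by
      have h0 : (fun s : ℝ => (lam + s • v, (0 : ℝ))) 0 = (lam, 0) := by simp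
      have : HasFDerivAt F F' ((fun s : ℝ => (lam + s • v, (0 : ℝ))) 0) := by
        rw [h0]
        exact hder.hasFDerivAt
      exact hasDerivAt_pi.1 (HasFDerivAt.comp_hasDerivAt
        (f := fun s : ℝ => (lam + s • v, (0 : ℝ))) (0 : ℝ) this hline) j
    have hg : HasDerivAt (fun s : ℝ => lam j ^ 2 - (lam j + s * v j) ^ 2)
        (-(2 * lam j) * v j) 0 := by
      have := ((((hasDerivAt_id (0 : ℝ)).mul_const (v j)).const_add (lam j)).pow 2).const_sub
        (lam j ^ 2)
      exact this.congr_deriv (by simp)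
    have hh : DifferentiableAt ℝ (fun s : ℝ => (∏ l ∈ Finset.univ.erase j,
        (lam j ^ 2 - (lam l + s * v l) ^ 2)) * lam j ^ Fintype.card R) 0 := by
      fun_prop
    have h2 := hg.mul hh.hasDerivAt
    have heq : (fun s : ℝ => F (lam + s • v, 0) j) =
        (fun s : ℝ => lam j ^ 2 - (lam j + s * v j) ^ 2) * (fun s : ℝ =>
          (∏ l ∈ Finset.univ.erase j, (lam j ^ 2 - (lam l + s * v l) ^ 2)) *
            lam j ^ Fintype.card R) := by
      funext s
      rw [hF0, Pi.mul_apply, ← Finset.mul_prod_erase _ _ (Finset.mem_univ j), mul_assoc]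
      rfl
    rw [heq] at h1
    rw [h1.unique h2]
    simp only [zero_mul, add_zero, sub_self, d]
    ring
  have hΦ := hder.prodMk (hasStrictFDerivAt_snd (𝕜 := ℝ) (p := (lam, (0 : ℝ))))
  have hsurj : (F'.prod (ContinuousLinearMap.snd ℝ (ι → ℝ) ℝ)).range = ⊤ := by
    rw [LinearMap.range_eq_top]
    rintro ⟨w, r⟩
    refine ⟨(fun j => (w j - F' (0, r) j) / d j, r), Prod.ext ?_ rfl⟩
    funext j
    have hsplit : ((fun j => (w j - F' (0, r) j) / d j, r) : (ι → ℝ) × ℝ) =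
        (fun j => (w j - F' (0, r) j) / d j, 0) + (0, r) := by simp
    change F' (fun j => (w j - F' (0, r) j) / d j, r) j = w j
    rw [hsplit, map_add, Pi.add_apply, hpartial, mul_div_cancel₀ _ (hd j), sub_add_cancel]
  -- The image of `U` under `(F, snd)` is a neighbourhood of the origin, so it meets the
  -- punctured second axis.
  have hmap := hΦ.map_nhds_eq_of_surj hsurj
  have hFlam : F (lam, 0) = 0 := by
    funext j
    rw [hF0, Finset.prod_eq_zero (Finset.mem_univ j) (sub_self _), zero_mul]
    rfl
  have himg : (fun p => (F p, p.2)) '' U ∈ nhds ((0 : ι → ℝ), (0 : ℝ)) := by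
    rw [← hFlam, ← hmap]
    exact Filter.image_mem_map hU
  have hax : Filter.Tendsto (fun ε : ℝ => ((0 : ι → ℝ), ε)) (nhdsWithin 0 {0}ᶜ)
      (nhds ((0 : ι → ℝ), (0 : ℝ))) :=
    (Continuous.prodMk_right (0 : ι → ℝ)).continuousAt.tendsto.mono_left nhdsWithin_le_nhds
  obtain ⟨ε, ⟨p, hp, hpe⟩, hε⟩ :=
    ((hax.eventually himg).and self_mem_nhdsWithin).exists
  obtain ⟨hp1, rfl⟩ := Prod.ext_iff.1 hpe
  exact ⟨p, hp, hε, fun j => congrFun hp1 j⟩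

end Matrix

/-! ### Realizing the prescribed spectrum -/

/-- The edges of a matching, numbered and with their endpoints ordered. -/
theorem SimpleGraph.Subgraph.IsMatching.exists_embedding {V : Type*} [Finite V]
    {G : SimpleGraph V} {M : G.Subgraph} (hM : M.IsMatching) :
    ∃ e : Fin 2 × Fin M.edgeSet.ncard → V, Function.Injective e ∧
      ∀ l, G.Adj (e (0, l)) (e (1, l)) := by
  let φ : Fin M.edgeSet.ncard ≃ M.edgeSet :=
    (finCongr (Nat.card_coe_set_eq _).symm).trans (Finite.equivFin M.edgeSet).symm
  have hout : ∀ l, s((φ l).1.out.1, (φ l).1.out.2) = (φ l).1 := fun l => Quot.out_eq _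
  have hadj : ∀ l, M.Adj (φ l).1.out.1 (φ l).1.out.2 := fun l => by
    rw [← SimpleGraph.Subgraph.mem_edgeSet, hout]
    exact (φ l).2
  let e : Fin 2 × Fin M.edgeSet.ncard → V :=
    fun p => ![(φ p.2).1.out.1, (φ p.2).1.out.2] p.1
  have hmem : ∀ a l, e (a, l) ∈ (φ l).1 := fun a l => by
    rw [← hout l]
    fin_cases a
    · exact Sym2.mem_mk_left _ _
    · exact Sym2.mem_mk_right _ _
  refine ⟨e, ?_, fun l => (hadj l).adj_sub⟩
  rintro ⟨a, l⟩ ⟨b, m⟩ h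
  -- A vertex lies on at most one edge of a matching.
  have huniq : ∀ (x : V) (f g : Sym2 V), f ∈ M.edgeSet → g ∈ M.edgeSet → x ∈ f → x ∈ g →
      f = g := by
    intro x f g hf hg hxf hxg
    obtain ⟨y, rfl⟩ := hxf
    obtain ⟨z, rfl⟩ := hxg
    rw [show y = z from hM.eq_of_adj_left hf hg]
  have hlm : l = m := φ.injective (Subtype.ext
    (huniq _ _ _ (φ l).2 (φ m).2 (hmem a l) (by rw [h]; exact hmem b m)))
  subst hlm
  have hne := (hadj l).ne
  fin_cases a <;> fin_cases b
  · rfl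
  · exact absurd h hne
  · exact absurd h.symm hne
  · rfl

/-- Every finite graph is the graph of some skew-symmetric matrix: orient the edges. -/
theorem skewMatricesOf_nonempty {V : Type*} [Finite V] (G : SimpleGraph V) :
    (skewMatricesOf G).Nonempty := by
  classical
  let e := Finite.equivFin V
  let B : Matrix V V ℝ := fun u v => if G.Adj u v then (if e u < e v then 1 else -1) else 0
  refine ⟨B, ?_, ?_⟩
  · ext u v
    change B v u = -B u v
    by_cases h : G.Adj u v
    · have hne : e u ≠ e v := fun h' => h.ne (e.injective h')
      rcases lt_or_gt_of_ne hne with hlt | hlt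
      · simp [B, h, h.symm, hlt, hlt.not_gt]
      · simp [B, h, h.symm, hlt, hlt.not_gt]
    · simp [B, h, G.adj_comm v u]
  · have hB : ∀ u v, B u v ≠ 0 ↔ G.Adj u v := fun u v => by
      by_cases h : G.Adj u v
      · by_cases h' : e u < e v <;> simp [B, h, h']
      · simp [B, h]
    ext u v
    simp only [graphOfMatrix, SimpleGraph.fromRel_adj, hB, G.adj_comm v u, or_self]
    exact ⟨fun h => h.2, fun h => ⟨h.ne, h⟩⟩

/-- The spectrum is known as soon as it contains `±i lam j` for all `j`, since the matching number
bounds the number of nonzero eigenvalues. -/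
theorem complexEigenvalues_eq_of_isRoot {V : Type*} [Fintype V] [DecidableEq V]
    {G : SimpleGraph V} {A : Matrix V V ℝ} (hA : A ∈ skewMatricesOf G) {k : ℕ}
    (hk : matchingNumber G = k) {lam : Fin k → ℝ} (hinj : Function.Injective lam)
    (hpos : ∀ j, 0 < lam j)
    (h : ∀ j, (A.map (fun x : ℝ => (x : ℂ))).charpoly.IsRoot (Complex.I * lam j) ∧
      (A.map (fun x : ℝ => (x : ℂ))).charpoly.IsRoot (-(Complex.I * lam j))) :
    complexEigenvalues A =
      (Finset.univ : Finset (Fin k)).val.map (fun j => Complex.I * (lam j : ℂ)) +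
      (Finset.univ : Finset (Fin k)).val.map (fun j => -(Complex.I * (lam j : ℂ))) +
      Multiset.replicate (Fintype.card V - 2 * k) (0 : ℂ) := by
  set p := (A.map (fun x : ℝ => (x : ℂ))).charpoly with hp
  have hp0 : p ≠ 0 := (Matrix.charpoly_monic _).ne_zero
  have hI : Function.Injective fun j => Complex.I * (lam j : ℂ) := fun i j hij =>
    hinj (Complex.ofReal_injective (mul_left_cancel₀ Complex.I_ne_zero hij))
  set N : Multiset ℂ :=
    (Finset.univ : Finset (Fin k)).val.map (fun j => Complex.I * (lam j : ℂ)) +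
      (Finset.univ : Finset (Fin k)).val.map (fun j => -(Complex.I * (lam j : ℂ))) with hN
  have hnodup : N.Nodup := by
    refine Multiset.nodup_add.2 ⟨Finset.univ.nodup.map hI,
      Finset.univ.nodup.map (neg_injective.comp hI), ?_⟩
    rw [Multiset.disjoint_left]
    rintro z hz hz'
    obtain ⟨i, -, rfl⟩ := Multiset.mem_map.1 hz
    obtain ⟨j, -, hj⟩ := Multiset.mem_map.1 hz'
    have him := congrArg Complex.im hj
    simp at him
    linarith [hpos i, hpos j]
  have hle : N ≤ p.roots.filter (fun z => z ≠ 0) := by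
    rw [Multiset.le_iff_subset hnodup]
    intro z hz
    rw [Multiset.mem_filter, Polynomial.mem_roots hp0]
    rcases Multiset.mem_add.1 hz with hz | hz
    · obtain ⟨j, -, rfl⟩ := Multiset.mem_map.1 hz
      exact ⟨(h j).1, by simp [(hpos j).ne']⟩
    · obtain ⟨j, -, rfl⟩ := Multiset.mem_map.1 hz
      exact ⟨(h j).2, by simp [(hpos j).ne']⟩
  have hcardN : N.card = 2 * k := by
    rw [hN, Multiset.card_add, Multiset.card_map, Multiset.card_map]
    simp [two_mul]
  have hub := card_nonzero_complexEigenvalues_le hA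
  rw [hk, complexEigenvalues, ← hp] at hub
  have hfilter : N = p.roots.filter (fun z => z ≠ 0) :=
    Multiset.eq_of_le_of_card_le hle (by rw [hcardN]; exact hub)
  have hsplit := Multiset.filter_add_not (fun z => z ≠ 0) p.roots
  have hzero : p.roots.filter (fun z => ¬ z ≠ 0) =
      Multiset.replicate (Fintype.card V - 2 * k) (0 : ℂ) := by
    refine Multiset.eq_replicate.2 ⟨?_, fun z hz => not_not.1 (Multiset.mem_filter.1 hz).2⟩
    have hc := congrArg Multiset.card hsplit
    rw [Multiset.card_add, ← hfilter, hcardN, ← (IsAlgClosed.splits p).natDegree_eq_card_roots,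
      Matrix.charpoly_natDegree_eq_dim] at hc
    omega
  rw [complexEigenvalues, ← hp, ← hsplit, ← hfilter, hzero]

/-- A graph of matching number `k` realizes every set of `k` distinct conjugate pairs: perturb a
weighted maximum matching by a small multiple of any matrix of the graph. -/
theorem exists_complexEigenvalues_eq {V : Type*} [Fintype V] [DecidableEq V] {G : SimpleGraph V}
    {k : ℕ} (hk : matchingNumber G = k) {lam : Fin k → ℝ} (hinj : Function.Injective lam)
    (hpos : ∀ j, 0 < lam j) :
    ∃ A ∈ skewMatricesOf G,
      complexEigenvalues A =
        (Finset.univ : Finset (Fin k)).val.map (fun j => Complex.I * (lam j : ℂ)) +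
        (Finset.univ : Finset (Fin k)).val.map (fun j => -(Complex.I * (lam j : ℂ))) +
        Multiset.replicate (Fintype.card V - 2 * k) (0 : ℂ) := by
  classical
  obtain ⟨M, hM, hMk⟩ := (matchingNumber_isGreatest G).1
  obtain rfl := hMk.trans hk
  obtain ⟨e, he, hadj⟩ := hM.exists_embedding
  let R := {v // v ∉ Set.range e}
  let φ : (Fin 2 × Fin M.edgeSet.ncard) ⊕ R ≃ V :=
    ((Equiv.ofInjective e he).sumCongr (Equiv.refl R)).trans (Equiv.Set.sumCompl (Set.range e))
  have hφ : ∀ p, φ (Sum.inl p) = e p := fun p => rfl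
  obtain ⟨B, hB⟩ := skewMatricesOf_nonempty G
  have hBskew : ∀ u v, B v u = -B u v := fun u v => congrFun (congrFun hB.1 u) v
  have hBadj : ∀ u v, u ≠ v → (G.Adj u v ↔ B u v ≠ 0) :=
    fun u v huv => adj_iff_of_mem_skewMatricesOf hB huv
  -- For weights near `lam` the perturbation does not cancel the entries at the matching edges.
  have hU : {p : (Fin M.edgeSet.ncard → ℝ) × ℝ |
      ∀ l, p.1 l + p.2 * B (e (0, l)) (e (1, l)) ≠ 0} ∈ nhds (lam, (0 : ℝ)) := by
    refine Filter.eventually_all.2 fun l => ?_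
    have hc : Continuous fun p : (Fin M.edgeSet.ncard → ℝ) × ℝ =>
        p.1 l + p.2 * B (e (0, l)) (e (1, l)) := by fun_prop
    exact hc.continuousAt.eventually_ne (by simp [(hpos l).ne'])
  obtain ⟨⟨t, ε⟩, hmem, hε, hroot⟩ :=
    Matrix.exists_reDet_weightedMatching_add_eq_zero (B.submatrix φ φ) hinj hpos hU
  simp only at hε hroot
  have hp : ∀ l, t l + ε * B (e (0, l)) (e (1, l)) ≠ 0 := hmem
  set W := Matrix.weightedMatching R t + ε • B.submatrix φ φ with hW
  have hentry : ∀ i j, W i j = Matrix.weightedMatching R t i j + ε * B (φ i) (φ j) :=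
    fun i j => rfl
  have hskew : ∀ i j, W j i = -W i j := by
    intro i j
    rw [hentry, hentry, hBskew (φ i) (φ j)]
    have : Matrix.weightedMatching R t j i = -Matrix.weightedMatching R t i j := by
      rcases i with ⟨a, l⟩ | r <;> rcases j with ⟨b, m⟩ | r'
      · by_cases hlm : l = m
        · subst hlm
          fin_cases a <;> fin_cases b <;>
            simp [Matrix.weightedMatching, Matrix.blockDiagonal_apply]
        · simp [Matrix.weightedMatching, Matrix.blockDiagonal_apply, hlm, Ne.symm hlm]
      all_goals simp [Matrix.weightedMatching]
    rw [this]
    ring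
  have hnz : ∀ i j, i ≠ j → (G.Adj (φ i) (φ j) ↔ W i j ≠ 0) := by
    intro i j hij
    have hmain : Matrix.weightedMatching R t i j = 0 → (G.Adj (φ i) (φ j) ↔ W i j ≠ 0) := by
      intro h0
      rw [hentry, h0, zero_add, hBadj _ _ (fun h => hij (φ.injective h)), mul_ne_zero_iff,
        and_iff_right hε]
    rcases i with ⟨a, l⟩ | r <;> rcases j with ⟨b, m⟩ | r'
    · by_cases hlm : l = m
      · subst hlm
        have hkey : W (Sum.inl (0, l)) (Sum.inl (1, l)) ≠ 0 := by
          rw [hentry, hφ, hφ]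
          simpa [Matrix.weightedMatching, Matrix.blockDiagonal_apply] using hp l
        fin_cases a <;> fin_cases b
        · exact absurd rfl hij
        · refine iff_of_true ?_ hkey
          rw [hφ, hφ]
          exact hadj l
        · refine iff_of_true ?_ ?_
          · rw [hφ, hφ]
            exact (hadj l).symm
          · have := hskew (Sum.inl (0, l)) (Sum.inl (1, l))
            change W (Sum.inl (1, l)) (Sum.inl (0, l)) ≠ 0
            rw [this]
            exact neg_ne_zero.2 hkey
        · exact absurd rfl hij
      · exact hmain (by simp [Matrix.weightedMatching, Matrix.blockDiagonal_apply, hlm])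
    all_goals exact hmain (by simp [Matrix.weightedMatching])
  have hA : Matrix.reindex φ φ W ∈ skewMatricesOf G := by
    constructor
    · ext u v
      exact hskew _ _
    · ext u v
      obtain ⟨i, rfl⟩ := φ.surjective u
      obtain ⟨j, rfl⟩ := φ.surjective v
      simp only [graphOfMatrix, SimpleGraph.fromRel_adj, Matrix.reindex_apply,
        Matrix.submatrix_apply, Equiv.symm_apply_apply, hskew i j, neg_ne_zero, or_self,
        φ.injective.ne_iff]
      exact ⟨fun h => (hnz i j h.1).2 h.2,
        fun h => have hij : i ≠ j := fun h' => h.ne (congrArg φ h')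
          ⟨hij, (hnz i j hij).1 h⟩⟩
  refine ⟨_, hA, complexEigenvalues_eq_of_isRoot hA hk hinj hpos fun j => ?_⟩
  have hmap : (Matrix.reindex φ φ W).map (fun x : ℝ => (x : ℂ)) =
      Matrix.reindex φ φ (W.map (fun x : ℝ => (x : ℂ))) := rfl
  rw [hmap, Matrix.charpoly_reindex]
  exact Matrix.isRoot_charpoly_of_reDet_eq_zero (Matrix.ext hskew) (hroot j)

theorem mainTheorem1 {V : Type*} [Fintype V] [DecidableEq V] (G : SimpleGraph V)
    (n k : ℕ) (hn : Fintype.card V = n) (hk : 2 * k ≤ n)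
    (lam : Fin k → ℝ) (hanti : StrictAnti lam) (hpos : ∀ j, 0 < lam j) :
    matchingNumber G = k ↔
      (∃ A ∈ skewMatricesOf G,
        complexEigenvalues A =
          (Finset.univ : Finset (Fin k)).val.map (fun j => Complex.I * (lam j : ℂ)) +
          (Finset.univ : Finset (Fin k)).val.map (fun j => -(Complex.I * (lam j : ℂ))) +
          Multiset.replicate (n - 2 * k) (0 : ℂ)) ∧
      (∀ A ∈ skewMatricesOf G,
        ((complexEigenvalues A).filter (fun z => z ≠ 0)).card ≤ 2 * k) := by
  subst hn
  have hcount : ∀ {m r : ℕ} (μ : Fin m → ℝ), (∀ j, 0 < μ j) →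
      2 * m ≤ (((Finset.univ : Finset (Fin m)).val.map (fun j => Complex.I * (μ j : ℂ)) +
        (Finset.univ : Finset (Fin m)).val.map (fun j => -(Complex.I * (μ j : ℂ))) +
        Multiset.replicate r (0 : ℂ)).filter (fun z => z ≠ 0)).card := by
    intro m r μ hμ
    rw [Multiset.filter_add, Multiset.filter_add, Multiset.card_add, Multiset.card_add,
      Multiset.filter_eq_self.2, Multiset.filter_eq_self.2, Multiset.card_map, Multiset.card_map]
    · simp [two_mul]
    all_goals
      intro z hz
      obtain ⟨j, -, rfl⟩ := Multiset.mem_map.1 hz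
      simp [(hμ j).ne']
  constructor
  · intro h
    refine ⟨exists_complexEigenvalues_eq h hanti.injective hpos, fun A hA => ?_⟩
    rw [← h]
    exact card_nonzero_complexEigenvalues_le hA
  · rintro ⟨⟨A, hA, hspec⟩, hle⟩
    apply le_antisymm
    · -- Some matrix of the graph has twice the matching number of nonzero eigenvalues.
      have hμ : ∀ j : Fin (matchingNumber G), (0 : ℝ) < (j : ℕ) + 1 := fun j => by positivity
      obtain ⟨A', hA', hspec'⟩ := exists_complexEigenvalues_eq (G := G) rfl
        (lam := fun j => (j : ℕ) + 1) (fun i j hij => by simpa [Fin.ext_iff] using hij) hμ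
      have h1 := hle A' hA'
      rw [hspec'] at h1
      have h2 := (hcount _ hμ).trans h1
      omega
    · have h1 := card_nonzero_complexEigenvalues_le hA
      rw [hspec] at h1
      have h2 := (hcount lam hpos).trans h1
      omega
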